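/- Let $F_2=F(a,b)$ be the free group of rank two, and let $\psi:F_2\to F_2$ be a non-surjective monomorphism. Write $\operatorname{Fix}(\psi)=\{x\in F_2\mid\psi(x)=x\}$. An element of $F_2$ is called primitive if it belongs to some free basis of $F_2$; it is called a proper power if it equals $u^n$ for some $u\in F_2$ and some integer $n\ge 2$ (so $1$ is a proper power); and a maximal fixed point of $\psi$ is an element of $\operatorname{Fix}(\psi)$ that is not a proper power. Then the following hold. (1) If $w\in F_2$, $w\neq 1$ and $\psi(w)=w$, then there exist a primitive element $x$ and an integer $i$ such that $w=x^i$ and $\psi(x)=x$. (2) Either $\operatorname{Fix}(\psi)=\{1\}$, or there is a primitive element $x$ such that $\operatorname{Fix}(\psi)=\langle x\rangle$ is infinite cyclic and $x$ and $x^{-1}$ are the only maximal fixed points of $\psi$, i.e. the set of maximal fixed points of $\psi$ is exactly $\{x,x^{-1}\}$. -/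

import Mathlib

universe u

/-- An element of a group is primitive if it belongs to some free basis of the group. -/
def IsPrimitiveElement {G : Type u} [Group G] (x : G) : Prop :=
  ∃ (ι : Type u) (b : FreeGroupBasis ι G) (i : ι), b i = x

/-- The fixed subgroup `Fix(ψ) = {x | ψ x = x}` of an endomorphism of a group. -/
def fixedSubgroup {G : Type u} [Group G] (ψ : G →* G) : Subgroup G :=
  ψ.eqLocus (MonoidHom.id G)

/-- An element is a proper power if it is `u ^ n` with `n ≥ 2`. In particular the identity
is a proper power. Negative exponents give nothing new, since `u ^ (-n) = (u⁻¹) ^ n`. -/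
def IsProperPower {G : Type u} [Group G] (x : G) : Prop :=
  ∃ (u : G) (n : ℕ), 2 ≤ n ∧ x = u ^ n

/-- A maximal fixed point of an endomorphism is a fixed point that is not a proper power. -/
def IsMaximalFixedPoint {G : Type u} [Group G] (ψ : G →* G) (x : G) : Prop :=
  x ∈ fixedSubgroup ψ ∧ ¬ IsProperPower x

/-! Every iterate `ψ^n` is injective and fixes the fixed point `w`. Nielsen reduction
(`exists_isNielsenReduced`) yields a basis whose image under `ψ^n` is Nielsen reduced; then each
basis letter occurring in `w` has image no longer than `w` (`norm_le_of_isNielsenReduced`). If for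
some `n` at most one letter occurs, `w` is a power of a basis element. Otherwise all the image pairs
lie in one finite ball, so two coincide for some `n < m`; then `ψ^n` and `ψ^m` have the same image,
and cancelling `ψ^n` makes `ψ` surjective.

For the fixed subgroup, a commutator of fixed points is fixed, so it is a power of a primitive
element; a homomorphism to `ℤ` forces the exponent to be 0. Hence all fixed points centralize one
primitive element, whose centralizer is cyclic. -/

namespace FreeGroup

variable {α : Type*} [DecidableEq α]

/-! ### Word metric and the four-point condition -/

/-- The length of the longest common prefix of two lists. -/
def commonPrefixLength {β : Type*} [DecidableEq β] : List β → List β → ℕ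
  | a :: L, b :: M => if a = b then commonPrefixLength L M + 1 else 0
  | _, _ => 0

/-- This ultrametric inequality is the source of `norm_four_point`. -/
theorem min_commonPrefixLength_le {β : Type*} [DecidableEq β] (L M N : List β) :
    min (commonPrefixLength L M) (commonPrefixLength M N) ≤ commonPrefixLength L N := by
  induction L generalizing M N with
  | nil => cases M <;> simp [commonPrefixLength]
  | cons a L ih =>
    rcases M with _ | ⟨b, M⟩
    · simp [commonPrefixLength]
    rcases N with _ | ⟨c, N⟩
    · simp [commonPrefixLength]
    have := ih M N
    simp only [commonPrefixLength]
    split_ifs <;> first | omega | simp_all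

theorem IsReduced.invRev {L : List (α × Bool)} (h : IsReduced L) :
    IsReduced (FreeGroup.invRev L) := by
  rw [isReduced_iff_reduce_eq, reduce_invRev, h.reduce_eq]

theorem norm_mk_of_isReduced {L : List (α × Bool)} (h : IsReduced L) :
    norm (mk L) = L.length := by
  rw [norm, toWord_mk, h.reduce_eq]

theorem norm_inv_mk_mul_mk {L M : List (α × Bool)} (hL : IsReduced L) (hM : IsReduced M) :
    norm ((mk L)⁻¹ * mk M) + 2 * commonPrefixLength L M = L.length + M.length := by
  induction L generalizing M with
  | nil =>
    rw [← one_eq_mk, inv_one, one_mul, norm_mk_of_isReduced hM]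
    simp [commonPrefixLength]
  | cons a L ih =>
    rcases M with _ | ⟨b, M⟩
    · rw [← one_eq_mk, mul_one, norm_inv_eq, norm_mk_of_isReduced hL]
      simp [commonPrefixLength]
    by_cases hab : a = b
    · subst hab
      have h1 : ∀ K : List (α × Bool), mk (a :: K) = mk [a] * mk K := fun K => by simp
      have h2 := ih (hL.infix (List.suffix_cons a L).isInfix)
        (hM.infix (List.suffix_cons a M).isInfix)
      rw [h1 L, h1 M, mul_inv_rev, mul_assoc, inv_mul_cancel_left]
      simp only [commonPrefixLength, if_true, List.length_cons]
      omega
    · have h3 : IsReduced (FreeGroup.invRev (a :: L) ++ (b :: M)) := by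
        have e : FreeGroup.invRev (a :: L) ++ (b :: M)
            = FreeGroup.invRev L ++ [(a.1, !a.2)] ++ (b :: M) := by
          simp [FreeGroup.invRev]
        rw [e]
        refine IsReduced.append_overlap ?_ ?_ (by simp)
        · simpa [FreeGroup.invRev] using hL.invRev
        · rw [List.singleton_append, isReduced_cons_cons]
          refine ⟨fun h => ?_, hM⟩
          obtain ⟨a1, a2⟩ := a
          obtain ⟨b1, b2⟩ := b
          simp only at h
          subst h
          cases a2 <;> cases b2 <;> simp_all
      rw [inv_mk, mul_mk, norm_mk_of_isReduced h3]
      simp [commonPrefixLength, hab, invRev_length]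

/-- The four-point condition for the word metric on a free group. -/
theorem norm_four_point (x y z : FreeGroup α) :
    norm (x⁻¹ * z) + norm y ≤ max (norm (x⁻¹ * y) + norm z) (norm (y⁻¹ * z) + norm x) := by
  have key : ∀ s t : FreeGroup α,
      norm (s⁻¹ * t) + 2 * commonPrefixLength s.toWord t.toWord = norm s + norm t := fun s t => by
    have := norm_inv_mk_mul_mk (isReduced_toWord (x := s)) (isReduced_toWord (x := t))
    rwa [mk_toWord, mk_toWord] at this
  have h := min_commonPrefixLength_le x.toWord y.toWord z.toWord
  have h1 := key x z
  have h2 := key x y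
  have h3 := key y z
  omega

/-- Write `x = c r c⁻¹` with `r` cyclically reduced and nonempty; squaring lengthens the reduced
word by `|r|`. -/
theorem norm_lt_norm_mul_self {x : FreeGroup α} (hx : x ≠ 1) : norm x < norm (x * x) := by
  have h0 := reduceCyclically.conj_conjugator_reduceCyclically x.toWord
  have h1 := reduceCyclically.reduce_flatten_replicate (isReduced_toWord (x := x)) 2
  rw [← toWord_pow] at h1
  have h2 := congrArg List.length h0
  have h3 := congrArg List.length h1
  have h4 : (reduceCyclically x.toWord).length ≠ 0 := by
    intro h
    rw [List.length_eq_zero_iff] at h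
    rw [h] at h0
    apply hx
    rw [← mk_toWord (x := x), ← h0, List.append_nil, ← mul_mk, ← inv_mk, mul_inv_cancel]
  rw [← pow_two]
  simp [invRev_length] at h2 h3
  simp only [norm]
  omega

/-! ### Nielsen reduced families -/

/-- The images of the basis under `θ` form a Nielsen reduced family. -/
structure IsNielsenReduced {ι : Type*} (θ : FreeGroup ι →* FreeGroup α) : Prop where
  norm_le_left : ∀ l m : ι × Bool, (l.1 = m.1 → l.2 = m.2) →
    norm (θ (mk [l])) ≤ norm (θ (mk [l]) * θ (mk [m]))
  norm_le_right : ∀ l m : ι × Bool, (l.1 = m.1 → l.2 = m.2) →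
    norm (θ (mk [m])) ≤ norm (θ (mk [l]) * θ (mk [m]))
  norm_add_lt : ∀ l m r : ι × Bool, (l.1 = m.1 → l.2 = m.2) → (m.1 = r.1 → m.2 = r.2) →
    norm (θ (mk [l])) + norm (θ (mk [r])) <
      norm (θ (mk [l]) * θ (mk [m])) + norm (θ (mk [m]) * θ (mk [r]))

/-- The image of `l` cancels against the whole word exactly as against its first letter: by
`norm_add_lt`, the cancellations on the two sides of a letter never exhaust it. -/
theorem norm_letter_mul_of_isNielsenReduced {ι : Type*} {θ : FreeGroup ι →* FreeGroup α}
    (h : IsNielsenReduced θ) (L : List (ι × Bool)) (m : ι × Bool) (hL : IsReduced (m :: L)) :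
    (∀ l : ι × Bool, (l.1 = m.1 → l.2 = m.2) →
      norm (θ (mk [l]) * θ (mk (m :: L))) + norm (θ (mk [m])) =
        norm (θ (mk [l]) * θ (mk [m])) + norm (θ (mk (m :: L)))) ∧
    ∀ k ∈ m :: L, norm (θ (mk [k])) ≤ norm (θ (mk (m :: L))) := by
  induction L generalizing m with
  | nil => simp
  | cons k L ih =>
    rw [isReduced_cons_cons] at hL
    obtain ⟨h1, h2⟩ := ih k hL.2
    have e : θ (mk (m :: k :: L)) = θ (mk [m]) * θ (mk (k :: L)) := by
      rw [← _root_.map_mul, mul_mk, List.singleton_append]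
    rw [e]
    have h3 := h1 m hL.1
    have h4 := h.norm_le_left m k hL.1
    have h5 := h.norm_le_right m k hL.1
    have h6 := h2 k (by simp)
    refine ⟨fun l hl => ?_, fun j hj => ?_⟩
    · have h7 := h.norm_add_lt l m k hl hL.1
      -- Of the three sums in the four-point condition, `norm_add_lt` rules out one as the largest,
      -- so the other two are equal.
      have h8 := norm_four_point (θ (mk [l]))⁻¹ (θ (mk [m])) (θ (mk [m]) * θ (mk (k :: L)))
      have h9 := norm_four_point (θ (mk [l]))⁻¹ (θ (mk [m]) * θ (mk (k :: L))) (θ (mk [m]))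
      rw [inv_inv, norm_inv_eq, inv_mul_cancel_left] at h8
      rw [inv_inv, norm_inv_eq, mul_inv_rev, inv_mul_cancel_right, norm_inv_eq] at h9
      omega
    · rcases List.mem_cons.1 hj with rfl | hj
      · omega
      · have := h2 j hj
        omega

theorem norm_le_of_isNielsenReduced {ι : Type*} {θ : FreeGroup ι →* FreeGroup α}
    (h : IsNielsenReduced θ) {L : List (ι × Bool)} (hL : IsReduced L) {k : ι × Bool}
    (hk : k ∈ L) : norm (θ (of k.1)) ≤ norm (θ (mk L)) := by
  rcases L with _ | ⟨m, L⟩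
  · simp at hk
  have := (norm_letter_mul_of_isNielsenReduced h L m hL).2 k hk
  obtain ⟨i, b⟩ := k
  cases b
  · have e : mk [(i, false)] = (of i)⁻¹ := rfl
    rwa [e, _root_.map_inv, norm_inv_eq] at this
  · exact this


/-! ### Nielsen reduction in rank two -/

/-- Numerical conditions on a pair that force it to be Nielsen reduced. -/
structure IsNielsenReducedPair (u v : FreeGroup α) : Prop where
  ne_one_left : u ≠ 1
  ne_one_right : v ≠ 1
  le_mul : max (norm u) (norm v) ≤ norm (u * v)
  le_mul_inv : max (norm u) (norm v) ≤ norm (u * v⁻¹)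
  le_inv_mul : max (norm u) (norm v) ≤ norm (u⁻¹ * v)
  le_mul_swap : max (norm u) (norm v) ≤ norm (v * u)
  not_eq : ¬(norm (u * v) = max (norm u) (norm v) ∧ norm (v * u) = max (norm u) (norm v))
  not_eq_inv :
    ¬(norm (u * v⁻¹) = max (norm u) (norm v) ∧ norm (u⁻¹ * v) = max (norm u) (norm v))

theorem norm_inv_mul_inv (x y : FreeGroup α) : norm (x⁻¹ * y⁻¹) = norm (y * x) := by
  rw [← mul_inv_rev, norm_inv_eq]

theorem norm_inv_mul_comm (x y : FreeGroup α) : norm (x⁻¹ * y) = norm (y⁻¹ * x) := by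
  rw [← norm_inv_eq, mul_inv_rev, inv_inv]

theorem norm_mul_inv_comm (x y : FreeGroup α) : norm (x * y⁻¹) = norm (y * x⁻¹) := by
  rw [← norm_inv_eq, mul_inv_rev, inv_inv]

/-- Since `|u| < |u * u|` for `u ≠ 1`, this excludes `|u * v⁻¹|` and `|v * u|` both being at most
`|v|`. -/
theorem norm_mul_self_add_le (u v : FreeGroup α) :
    norm (u * u) + norm v ≤ max (norm (u * v⁻¹)) (norm (v * u)) + norm u := by
  have t := norm_four_point u v⁻¹ u⁻¹
  rw [norm_inv_mul_inv, norm_inv_mul_inv, inv_inv, norm_inv_eq, norm_inv_eq,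
    norm_mul_inv_comm v u] at t
  omega

theorem isNielsenReduced_of_pair {θ : FreeGroup (Fin 2) →* FreeGroup α}
    (h : IsNielsenReducedPair (θ (of 0)) (θ (of 1))) : IsNielsenReduced θ := by
  obtain ⟨hu1, hv1, h1, h2, h3, h4, h5, h6⟩ := h
  generalize hu : θ (of 0) = u at *
  generalize hv : θ (of 1) = v at *
  have e1 := norm_inv_mul_comm v u
  have e2 := norm_mul_inv_comm v u
  have s1 := norm_lt_norm_mul_self hu1
  have s2 := norm_lt_norm_mul_self hv1
  have t1 := norm_mul_self_add_le u v
  have t2 := norm_mul_self_add_le u v⁻¹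
  have t3 := norm_mul_self_add_le v u
  have t4 := norm_mul_self_add_le v u⁻¹
  simp only [inv_inv, norm_inv_eq, e1, e2] at t1 t2 t3 t4
  have l0 : ∀ i, θ (mk [(i, true)]) = θ (of i) := fun i => rfl
  have l1 : ∀ i, θ (mk [(i, false)]) = (θ (of i))⁻¹ := fun i => by
    rw [← _root_.map_inv]; rfl
  have k1 : ∀ l m : Fin 2 × Bool, (l.1 = m.1 → l.2 = m.2) →
      max (norm (θ (mk [l]))) (norm (θ (mk [m]))) ≤ norm (θ (mk [l]) * θ (mk [m])) := by
    rintro ⟨i, b⟩ ⟨j, c⟩ h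
    rw [max_le_iff] at *
    fin_cases i <;> fin_cases j <;> cases b <;> cases c <;>
      simp [l0, l1, hu, hv, norm_inv_mul_inv, e1, e2, -mul_inv_rev] at h ⊢ <;> omega
  refine ⟨fun l m h => (le_max_left _ _).trans (k1 l m h),
    fun l m h => (le_max_right _ _).trans (k1 l m h), ?_⟩
  -- Equality would need both products to have the maximal length: `h5`, `h6` exclude two of the
  -- four cases, the bounds on squares the other two.
  have a1 : 2 * norm u < norm (u * v) + norm (u * v⁻¹) ∧
      2 * norm u < norm (u * v) + norm (v * u) ∧
      2 * norm u < norm (u⁻¹ * v) + norm (u * v⁻¹) ∧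
      2 * norm u < norm (u⁻¹ * v) + norm (v * u) := by omega
  have a2 : 2 * norm v < norm (u * v) + norm (u⁻¹ * v) ∧
      2 * norm v < norm (u * v) + norm (v * u) ∧
      2 * norm v < norm (u * v⁻¹) + norm (u⁻¹ * v) ∧
      2 * norm v < norm (u * v⁻¹) + norm (v * u) := by omega
  clear t1 t2 t3 t4 h5 h6 k1
  rw [max_le_iff] at h1 h2 h3 h4
  rintro ⟨i, b⟩ ⟨j, c⟩ ⟨k, d⟩ h h'
  fin_cases i <;> fin_cases j <;> fin_cases k <;> cases b <;> cases c <;> cases d <;>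
    simp [l0, l1, hu, hv, norm_inv_mul_inv, e1, e2, -mul_inv_rev] at h h' ⊢ <;> omega

/-- If `u`, `v` has minimal total length among the pairs of a family closed under Nielsen moves,
then no product of the two is shorter than either. -/
theorem max_norm_le_of_minimal {S : FreeGroup α → FreeGroup α → Prop}
    (swap : ∀ u v, S u v → S v u) (inv : ∀ u v, S u v → S u v⁻¹)
    (mul : ∀ u v, S u v → S u (v * u)) {n : ℕ} (min : ∀ u v, S u v → n ≤ norm u + norm v)
    {u v : FreeGroup α} (h : S u v) (hn : norm u + norm v = n) :
    max (norm u) (norm v) ≤ norm (u * v) := by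
  have h1 := min _ _ (mul _ _ (swap _ _ h))
  have h2 := min _ _ (mul _ _ (inv _ _ (swap _ _ (inv _ _ (swap _ _ h)))))
  rw [norm_inv_mul_inv, norm_inv_eq] at h2
  omega

/-- Minimality gives everything but the two tie conditions. A tie is broken by multiplying the
longer element by the shorter, which keeps the total length minimal. -/
theorem exists_isNielsenReducedPair_of_minimal {S : FreeGroup α → FreeGroup α → Prop}
    (swap : ∀ u v, S u v → S v u) (inv : ∀ u v, S u v → S u v⁻¹)
    (mul : ∀ u v, S u v → S u (v * u)) (ne_one : ∀ u v, S u v → u ≠ 1)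
    {n : ℕ} (min : ∀ u v, S u v → n ≤ norm u + norm v)
    {u v : FreeGroup α} (h : S u v) (hn : norm u + norm v = n) :
    ∃ u v, S u v ∧ IsNielsenReducedPair u v := by
  have le : ∀ u v, S u v → norm u + norm v = n → max (norm u) (norm v) ≤ norm (u * v) :=
    fun u v => max_norm_le_of_minimal swap inv mul min
  have good : ∀ u v, S u v → norm u + norm v = n →
      ¬(norm (u * v) = max (norm u) (norm v) ∧ norm (v * u) = max (norm u) (norm v)) →
      ¬(norm (u * v⁻¹) = max (norm u) (norm v) ∧ norm (u⁻¹ * v) = max (norm u) (norm v)) →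
      ∃ u v, S u v ∧ IsNielsenReducedPair u v := by
    intro u v h hn h5 h6
    have h2 := le _ _ (inv _ _ h) (by rwa [norm_inv_eq])
    have h3 := le _ _ (swap _ _ (inv _ _ (swap _ _ h))) (by rwa [norm_inv_eq])
    have h4 := le _ _ (swap _ _ h) (by omega)
    rw [norm_inv_eq] at h2 h3
    exact ⟨u, v, h, ne_one _ _ h, ne_one _ _ (swap _ _ h), le _ _ h hn, h2, h3,
      by rwa [max_comm], h5, h6⟩
  have core : ∀ u v, S u v → norm u + norm v = n → norm u ≤ norm v → norm (u * v) = norm v →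
      norm (v * u) = norm v → ∃ u v, S u v ∧ IsNielsenReducedPair u v := by
    intro u v h hn huv hA hD
    have s := norm_lt_norm_mul_self (ne_one _ _ h)
    have t1 := norm_mul_self_add_le u (v * u)
    have t2 := norm_mul_self_add_le u (v * u)⁻¹
    have t3 := norm_four_point u⁻¹ v (v * u)
    -- `t1` gives `|v * u * u| > |v|`; `t3` gives `|u * v * u| ≤ |v|`, whence `t2` gives `|u⁻¹ * v *
    -- u| > |v|`. So `(u, v * u)` has neither tie.
    have e : u * (v * u)⁻¹ = v⁻¹ := by group
    have e' : (v * u)⁻¹ * u = (u⁻¹ * (v * u))⁻¹ := by group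
    rw [e, norm_inv_eq] at t1
    rw [inv_inv, e', norm_inv_eq, norm_inv_eq] at t2
    rw [inv_inv, inv_mul_cancel_left, norm_inv_eq] at t3
    refine good u (v * u) (mul _ _ h) (by omega) ?_ ?_ <;> omega
  by_cases h5 : norm (u * v) = max (norm u) (norm v) ∧ norm (v * u) = max (norm u) (norm v)
  · rcases le_total (norm u) (norm v) with hle | hle
    · exact core u v h hn hle (by omega) (by omega)
    · exact core v u (swap _ _ h) (by omega) hle (by omega) (by omega)
  by_cases h6 : norm (u * v⁻¹) = max (norm u) (norm v) ∧ norm (u⁻¹ * v) = max (norm u) (norm v)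
  · have e1 := norm_inv_mul_comm v u
    have e2 := norm_mul_inv_comm v u
    rcases le_total (norm u) (norm v) with hle | hle
    · refine core u v⁻¹ (inv _ _ h) ?_ ?_ ?_ ?_ <;> simp only [norm_inv_eq] <;> omega
    · refine core v u⁻¹ (inv _ _ (swap _ _ h)) ?_ ?_ ?_ ?_ <;> simp only [norm_inv_eq] <;> omega
  exact good u v h hn h5 h6

/-- The automorphism exchanging the generators. -/
def swapEquiv : FreeGroup (Fin 2) ≃* FreeGroup (Fin 2) :=
  freeGroupCongr (Equiv.swap 0 1)

/-- The automorphism inverting the second generator. -/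
def invEquiv : FreeGroup (Fin 2) ≃* FreeGroup (Fin 2) :=
  MonoidHom.toMulEquiv (lift ![of 0, (of 1)⁻¹]) (lift ![of 0, (of 1)⁻¹])
    (by ext i; fin_cases i <;> simp) (by ext i; fin_cases i <;> simp)

/-- The automorphism multiplying the second generator by the first. -/
def mulEquiv : FreeGroup (Fin 2) ≃* FreeGroup (Fin 2) :=
  MonoidHom.toMulEquiv (lift ![of 0, of 1 * of 0]) (lift ![of 0, of 1 * (of 0)⁻¹])
    (by ext i; fin_cases i <;> simp) (by ext i; fin_cases i <;> simp)

theorem exists_isNielsenReduced {φ : FreeGroup (Fin 2) →* FreeGroup α}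
    (hφ : Function.Injective φ) :
    ∃ e : FreeGroup (Fin 2) ≃* FreeGroup (Fin 2), IsNielsenReduced (φ.comp e.toMonoidHom) := by
  let S : FreeGroup α → FreeGroup α → Prop := fun u v =>
    ∃ e : FreeGroup (Fin 2) ≃* FreeGroup (Fin 2), φ (e (of 0)) = u ∧ φ (e (of 1)) = v
  have hex : ∃ n, ∃ u v, S u v ∧ norm u + norm v = n :=
    ⟨_, _, _, ⟨MulEquiv.refl _, rfl, rfl⟩, rfl⟩
  classical
  obtain ⟨u, v, h, hn⟩ := Nat.find_spec hex
  obtain ⟨u, v, ⟨e, rfl, rfl⟩, h'⟩ := exists_isNielsenReducedPair_of_minimal (S := S)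
    (by
      rintro u v ⟨e, rfl, rfl⟩
      exact ⟨swapEquiv.trans e, by simp [swapEquiv], by simp [swapEquiv]⟩)
    (by
      rintro u v ⟨e, rfl, rfl⟩
      exact ⟨invEquiv.trans e, by simp [invEquiv], by simp [invEquiv]⟩)
    (by
      rintro u v ⟨e, rfl, rfl⟩
      exact ⟨mulEquiv.trans e, by simp [mulEquiv], by simp [mulEquiv]⟩)
    (by
      rintro u v ⟨e, rfl, rfl⟩
      rw [Ne, map_eq_one_iff φ hφ, map_eq_one_iff e e.injective]
      exact of_ne_one 0)
    (fun u v h => Nat.find_min' hex ⟨u, v, h, rfl⟩) h hn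
  exact ⟨e, isNielsenReduced_of_pair h'⟩

/-! ### Fixed points through iterates -/

theorem finite_norm_le [Finite α] (n : ℕ) : {x : FreeGroup α | norm x ≤ n}.Finite :=
  Set.Finite.of_finite_image ((List.finite_length_le (α × Bool) n).subset (by
    rintro _ ⟨x, hx, rfl⟩
    exact hx)) toWord_injective.injOn

theorem mk_mem_zpowers {ι : Type*} (j : ι) (L : List (ι × Bool)) (h : ∀ k ∈ L, k.1 = j) :
    mk L ∈ Subgroup.zpowers (of j) := by
  induction L with
  | nil => exact one_mem _
  | cons k L ih =>
    have e : mk (k :: L) = mk [k] * mk L := by simp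
    rw [e]
    refine mul_mem ?_ (ih fun k hk => h k (by simp [hk]))
    obtain ⟨i, b⟩ := k
    obtain rfl : i = j := h (i, b) (by simp)
    cases b
    · exact inv_mem (Subgroup.mem_zpowers _)
    · exact Subgroup.mem_zpowers _

/-- A fixed point of an injective non-surjective endomorphism of the free group of rank two is a
power of a basis element. -/
theorem exists_mem_zpowers_of_fixed (ψ : FreeGroup (Fin 2) →* FreeGroup (Fin 2))
    (hinj : Function.Injective ψ) (hsurj : ¬ Function.Surjective ψ) {w : FreeGroup (Fin 2)}
    (hw : ψ w = w) :
    ∃ (e : FreeGroup (Fin 2) ≃* FreeGroup (Fin 2)) (j : Fin 2),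
      w ∈ Subgroup.zpowers (e (of j)) := by
  let ψ' : Monoid.End (FreeGroup (Fin 2)) := ψ
  let φ : ℕ → FreeGroup (Fin 2) →* FreeGroup (Fin 2) := fun n => ψ' ^ n
  have hφ : ∀ n x, φ n x = ψ^[n] x := fun n x => congrFun (Monoid.End.coe_pow _ ψ' n) x
  have hφi : ∀ n, Function.Injective (φ n) := fun n x y h => by
    rw [hφ, hφ] at h
    exact hinj.iterate n h
  have hφw : ∀ n, φ n w = w := fun n => by rw [hφ]; exact Function.iterate_fixed hw n
  choose e he using fun n => exists_isNielsenReduced (hφi n)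
  by_contra hcon
  push Not at hcon
  have hbound : ∀ n j, norm (φ n (e n (of j))) ≤ norm w := by
    intro n j
    by_cases hj : ∃ k ∈ ((e n).symm w).toWord, k.1 = j
    · obtain ⟨k, hk, rfl⟩ := hj
      have := norm_le_of_isNielsenReduced (he n) isReduced_toWord hk
      simpa [mk_toWord, hφw] using this
    · push Not at hj
      -- In `Fin 2`, `1 - j` is the index other than `j`.
      have := mk_mem_zpowers (1 - j) ((e n).symm w).toWord fun k hk => by
        have := hj k hk
        generalize k.1 = i at *
        fin_cases i <;> fin_cases j <;> simp_all
      rw [mk_toWord] at this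
      obtain ⟨i, hi⟩ := this
      refine (hcon (e n) (1 - j) ⟨i, ?_⟩).elim
      simp only at hi ⊢
      rw [← map_zpow, hi, MulEquiv.apply_symm_apply]
  have hfin : {f : Fin 2 → FreeGroup (Fin 2) | ∀ j, f j ∈
      {x : FreeGroup (Fin 2) | norm x ≤ norm w}}.Finite :=
    Set.Finite.pi' fun _ => finite_norm_le _
  obtain ⟨n, -, m, -, hne, heq⟩ := Set.infinite_univ.exists_ne_map_eq_of_mapsTo
    (f := fun n j => φ n (e n (of j))) (fun n _ => Set.mem_ofPred.2 (hbound n)) hfin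
  have key : ∀ n m, n < m →
      (fun j => φ n (e n (of j))) = (fun j => φ m (e m (of j))) → Function.Surjective ψ := by
    intro n m hnm heq x
    have hhom : (φ n).comp (e n).toMonoidHom = (φ m).comp (e m).toMonoidHom :=
      ext_hom _ _ fun j => congrFun heq j
    have h1 := DFunLike.congr_fun hhom ((e n).symm x)
    simp only [MonoidHom.comp_apply, MulEquiv.toMonoidHom_eq_coe, MonoidHom.coe_coe,
      MulEquiv.apply_symm_apply] at h1
    rw [hφ, hφ] at h1
    obtain ⟨k, rfl⟩ := Nat.exists_eq_add_of_lt hnm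
    rw [add_assoc, Function.iterate_add_apply] at h1
    have h2 := hinj.iterate n h1
    rw [Function.iterate_succ_apply'] at h2
    exact ⟨_, h2.symm⟩
  rcases lt_or_gt_of_ne hne with h | h
  · exact hsurj (key n m h heq)
  · exact hsurj (key m n h heq.symm)

/-! ### Centralizers, roots and the fixed subgroup -/

/-- The centralizer of a generator of a free group is the cyclic group it generates. -/
theorem mem_zpowers_of_commute_of {i : α} {z : FreeGroup α} (h : Commute (of i) z) :
    z ∈ Subgroup.zpowers (of i) := by
  induction hn : norm z using Nat.strong_induction_on generalizing z with
  | _ n ih =>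
  subst hn
  rcases hz : z.toWord with _ | ⟨⟨j, b⟩, L⟩
  · rw [toWord_eq_nil_iff] at hz
    rw [hz]
    exact one_mem _
  have hz' : z = mk [(j, b)] * mk L := by
    rw [mul_mk, List.singleton_append, ← hz, mk_toWord]
  have hred : IsReduced ((j, b) :: L) := hz ▸ isReduced_toWord
  by_cases hj : j = i
  · subst hj
    have hmem : mk [(j, b)] ∈ Subgroup.zpowers (of j) :=
      mk_mem_zpowers _ _ (by simp)
    have hc : Commute (of j) (mk [(j, b)]) := by
      obtain ⟨k, hk⟩ := hmem
      rw [← hk]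
      exact Commute.self_zpow _ _
    have hL : mk L = (mk [(j, b)])⁻¹ * z := by rw [hz', inv_mul_cancel_left]
    rw [hz']
    refine mul_mem hmem (ih (norm (mk L)) ?_ ?_ rfl)
    · rw [norm, norm, hz]
      have := norm_mk_le (L₁ := L)
      simp only [norm, List.length_cons] at this ⊢
      omega
    · rw [hL]
      exact hc.inv_right.mul_right h
  -- The word of `z * of i` is a sublist of that of `z` followed by `i`, and commutation gives it
  -- full length, so it begins with `j`; but `of i * z` begins with `i`.
  · exfalso
    have h1 : (of i * z).toWord = (i, true) :: (j, b) :: L := by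
      rw [← mk_toWord (x := z), hz, of, mul_mk, toWord_mk, List.singleton_append]
      exact IsReduced.reduce_eq (isReduced_cons_cons.2 ⟨fun h => (hj h.symm).elim, hred⟩)
    have h2 := toWord_mul_sublist z (of i)
    rw [← h.eq, h1, hz, toWord_of] at h2
    have h3 := h2.eq_of_length (by simp)
    simp only [List.cons_append, List.cons.injEq, Prod.mk.injEq] at h3
    exact hj h3.1.1.symm

end FreeGroup

theorem isPrimitiveElement_apply_of (e : FreeGroup (Fin 2) ≃* FreeGroup (Fin 2)) (j : Fin 2) :
    IsPrimitiveElement (e (FreeGroup.of j)) :=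
  ⟨Fin 2, FreeGroupBasis.ofRepr e.symm, j, rfl⟩

/-- The total exponent sum in a basis containing `x`; it detects proper powers and kills
commutators. -/
theorem IsPrimitiveElement.exists_hom {G : Type u} [Group G] {x : G}
    (hx : IsPrimitiveElement x) :
    ∃ f : G →* Multiplicative ℤ, f x = Multiplicative.ofAdd 1 := by
  obtain ⟨ι, b, i, rfl⟩ := hx
  refine ⟨b.lift fun _ => Multiplicative.ofAdd 1, ?_⟩
  simp

theorem IsPrimitiveElement.mem_zpowers_of_commute {G : Type u} [Group G] {x z : G}
    (hx : IsPrimitiveElement x) (h : Commute x z) : z ∈ Subgroup.zpowers x := by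
  classical
  obtain ⟨ι, b, i, rfl⟩ := hx
  have h' := h.map b.repr
  rw [FreeGroupBasis.repr_apply_coe] at h'
  obtain ⟨k, hk⟩ := FreeGroup.mem_zpowers_of_commute_of h'
  refine ⟨k, b.repr.injective ?_⟩
  simpa using hk

theorem IsPrimitiveElement.not_isProperPower {G : Type u} [Group G] {x : G}
    (hx : IsPrimitiveElement x) : ¬ IsProperPower x := by
  rintro ⟨y, n, hn, rfl⟩
  obtain ⟨f, hf⟩ := hx.exists_hom
  have h := congrArg Multiplicative.toAdd hf
  rw [map_pow, toAdd_pow, toAdd_ofAdd, nsmul_eq_mul] at h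
  have := Int.eq_one_or_neg_one_of_mul_eq_one h
  omega

theorem isProperPower_inv {G : Type u} [Group G] {x : G} (h : IsProperPower x) :
    IsProperPower x⁻¹ := by
  obtain ⟨y, n, hn, rfl⟩ := h
  exact ⟨y⁻¹, n, hn, (inv_pow y n).symm⟩

theorem isProperPower_zpow {G : Type u} [Group G] (x : G) {k : ℤ} (h1 : k ≠ 1)
    (h2 : k ≠ -1) : IsProperPower (x ^ k) := by
  rcases eq_or_ne k 0 with rfl | h0
  · exact ⟨1, 2, le_rfl, by simp⟩
  rcases Int.natAbs_eq k with hk | hk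
  · exact ⟨x, k.natAbs, by omega, by rw [← zpow_natCast, ← hk]⟩
  · exact ⟨x⁻¹, k.natAbs, by omega, by rw [inv_pow, ← zpow_natCast, ← zpow_neg, ← hk]⟩

theorem exists_primitive_root_of_fixed (ψ : FreeGroup (Fin 2) →* FreeGroup (Fin 2))
    (hinj : Function.Injective ψ) (hsurj : ¬ Function.Surjective ψ) {w : FreeGroup (Fin 2)}
    (hw1 : w ≠ 1) (hw : ψ w = w) :
    ∃ x : FreeGroup (Fin 2), IsPrimitiveElement x ∧ (∃ i : ℤ, w = x ^ i) ∧ ψ x = x := by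
  obtain ⟨e, j, i, hi⟩ := FreeGroup.exists_mem_zpowers_of_fixed ψ hinj hsurj hw
  simp only at hi
  refine ⟨_, isPrimitiveElement_apply_of e j, ⟨i, hi.symm⟩, ?_⟩
  have hi0 : i ≠ 0 := by
    rintro rfl
    exact hw1 (by rw [← hi, zpow_zero])
  -- Roots in a free group are unique, and `ψ x` and `x` have the same `i`-th power `w`.
  apply zpow_left_injective hi0
  simp only
  rw [← map_zpow, hi, hw]

/-- The fixed subgroup of an injective non-surjective endomorphism of the free group of rank two is
trivial or generated by a primitive element. -/
theorem mainTheorem6 (ψ : FreeGroup (Fin 2) →* FreeGroup (Fin 2))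
    (hinj : Function.Injective ψ) (hsurj : ¬ Function.Surjective ψ) :
    (∀ w : FreeGroup (Fin 2), w ≠ 1 → ψ w = w →
      ∃ x : FreeGroup (Fin 2), IsPrimitiveElement x ∧ (∃ i : ℤ, w = x ^ i) ∧ ψ x = x) ∧
    (fixedSubgroup ψ = ⊥ ∨
      ∃ x : FreeGroup (Fin 2), IsPrimitiveElement x ∧
        fixedSubgroup ψ = Subgroup.zpowers x ∧
        Infinite (fixedSubgroup ψ) ∧
        {y : FreeGroup (Fin 2) | IsMaximalFixedPoint ψ y} = {x, x⁻¹}) := by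
  have root : ∀ w : FreeGroup (Fin 2), w ≠ 1 → ψ w = w →
      ∃ x : FreeGroup (Fin 2), IsPrimitiveElement x ∧ (∃ i : ℤ, w = x ^ i) ∧ ψ x = x :=
    fun w => exists_primitive_root_of_fixed ψ hinj hsurj
  refine ⟨root, or_iff_not_imp_left.2 fun hbot => ?_⟩
  obtain ⟨w, hw, hw1⟩ := (fixedSubgroup ψ).bot_or_exists_ne_one.resolve_left hbot
  obtain ⟨x, hx, -, hψx⟩ := root w hw1 hw
  have hcomm : ∀ z, ψ z = z → Commute x z := by
    intro z hz
    by_contra hne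
    -- The commutator of `x` and `z` is fixed, so `root` applies to it if it is nontrivial.
    rw [← commutatorElement_eq_one_iff_commute, commutatorElement_def] at hne
    obtain ⟨p, hp, ⟨i, hi⟩, -⟩ := root _ hne (by
      rw [map_mul, map_mul, map_mul, map_inv, map_inv, hψx, hz])
    obtain ⟨f, hf⟩ := hp.exists_hom
    have h := congrArg f hi
    rw [map_mul, map_mul, map_mul, map_inv, map_inv, mul_right_comm (f x), mul_inv_cancel,
      one_mul, mul_inv_cancel, map_zpow, hf] at h
    have h' := congrArg Multiplicative.toAdd h
    simp only [toAdd_one, toAdd_zpow, toAdd_ofAdd, smul_eq_mul, mul_one] at h'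
    exact hne (by rw [hi, ← h', zpow_zero])
  have hxmem : x ∈ fixedSubgroup ψ := hψx
  have hfix : fixedSubgroup ψ = Subgroup.zpowers x :=
    le_antisymm (fun z hz => hx.mem_zpowers_of_commute (hcomm z hz))
      (Subgroup.zpowers_le.2 hxmem)
  refine ⟨x, hx, hfix, ?_, ?_⟩
  · rw [hfix]
    refine Infinite.of_injective (fun n : ℤ => (⟨x ^ n, n, rfl⟩ : Subgroup.zpowers x)) ?_
    intro n m h
    obtain ⟨f, hf⟩ := hx.exists_hom
    have h' := congrArg f (congrArg Subtype.val h)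
    simpa [hf, ← ofAdd_zsmul] using h'
  · ext y
    simp only [Set.mem_ofPred_eq, Set.mem_insert_iff, Set.mem_singleton_iff]
    constructor
    · rintro ⟨hy, hyp⟩
      rw [hfix] at hy
      obtain ⟨k, rfl⟩ := hy
      by_contra hcon
      refine hyp (isProperPower_zpow x ?_ ?_) <;> rintro rfl <;> simp at hcon
    · rintro (rfl | rfl)
      · exact ⟨hxmem, hx.not_isProperPower⟩
      · refine ⟨inv_mem hxmem, fun h => hx.not_isProperPower ?_⟩
        rw [← inv_inv x]
        exact isProperPower_inv h
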